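/- **Setting.** For $X=(x_1,\dots,x_n)\in B_n=\{0,1\}^n$ let $|X|=\sum_{i=1}^n x_i$ and let $a_X=|X|/n$ be the Boolean mean. A quantum algorithm with $T$ queries for approximating the Boolean mean prepares, on input $X$, the state $$|\psi\rangle=U_TQ_XU_{T-1}Q_X\cdots U_1Q_XU_0|\psi_0\rangle$$ of some finite number of qubits, where $|\psi_0\rangle$ is a unit vector, $U_0,\dots,U_T$ are unitary transformations, none of these depend on $X$, and $Q_X$ is the query operator $|i\rangle|b\rangle|z\rangle\mapsto|i\rangle|b\oplus x_i\rangle|z\rangle$ (address strings $i$ are assigned to coordinates of $X$ by a fixed map independent of $X$; on an address string that names no coordinate, $Q_X$ acts as the identity). It then performs one measurement of $|\psi\rangle$, which does not depend on $X$ and gives one of $M$ outcomes, outcome $j\in\{0,\dots,M-1\}$ having probability $p_X(j)$, and returns a real number $\hat a(j)$ determined by the outcome $j$. For $q\in[1,\infty)$ and a probability measure $\mu$ on $B_n$, its average expected error is $$e^{\mathrm{avg\text{-}exp}}(q,B_n,T)=\sum_{X\in B_n}\Big\{\sum_{j=0}^{M-1}|a_X-\hat a(j)|^q\,p_X(j)\Big\}^{1/q}\mu(X).$$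 **Theorem 5.1.** For every $n$ let $I=I_n\subseteq\{0,\dots,n\}$ be a set of consecutive indices such that $|I|=\omega(1)$ as a function of $n$, and assume that $k(n-k)=\Theta(n^2)$ for every $k\in I$, that is, for some constants $\alpha,\beta>0$ and all large $n$, $\alpha n^2\le k(n-k)\le\beta n^2$ for every $k\in I$. Let $\mu=\mu_n$ be a probability measure on $B_n$ such that, for some constant $c>0$ and all large $n$, $$\mu(X)\ \ge\ \frac{c}{|I|}\cdot\frac1{\binom n{|X|}}\qquad\text{for every }X\in B_n\text{ with }|X|\in I.$$ Consider a fixed $q\in[1,\infty)$. Then for any $\varepsilon=\varepsilon(n)>0$ of order $o(|I|\,n^{-1})$, the condition $e^{\mathrm{avg\text{-}exp}}(q,B_n,T)\le\varepsilon$ implies that $T=\Omega(\min(\varepsilon^{-1},n))$. That is, there is a constant $C>0$, depending only on $\alpha,\beta,c$, such that for all sufficiently large $n$ (how large may depend on $q$ and on the sequences $I,\mu,\varepsilon$), every quantum algorithm whose average expected error is at most $\varepsilon(n)$ makes $T\ge C\min(\varepsilon(n)^{-1},n)$ queries. -/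

import Mathlib

open scoped Matrix

/-- A Boolean input `X = (x_1, ..., x_n)`. -/
abbrev BoolInput (n : ℕ) : Type := Fin n → Bool

namespace BoolInput

/-- The Hamming weight `|X| = ∑ i, x_i`. -/
def weight {n : ℕ} (X : BoolInput n) : ℕ := ∑ i, (X i).toNat

/-- The Boolean mean `a_X = |X| / n`. -/
noncomputable def mean {n : ℕ} (X : BoolInput n) : ℝ := (X.weight : ℝ) / n

end BoolInput

/-- Computational basis states `|i⟩|b⟩|z⟩` of a register of `m + 1 + w` qubits: an `m`-qubit
address `i`, one target qubit `b`, and a `w`-qubit workspace `z`. -/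
abbrev BasisState (m w : ℕ) : Type := (Fin m → Bool) × Bool × (Fin w → Bool)

/-- The action of the oracle on basis states: `|i⟩|b⟩|z⟩ ↦ |i⟩|b ⊕ x_{addr i}⟩|z⟩` if the
address string `i` names a coordinate of `X`, and `|i⟩|b⟩|z⟩` is left unchanged otherwise. -/
def oracleFlip {n m w : ℕ} (addr : (Fin m → Bool) → Option (Fin n)) (X : BoolInput n)
    (s : BasisState m w) : BasisState m w :=
  match addr s.1 with
  | some i => (s.1, xor s.2.1 (X i), s.2.2)
  | none => s

theorem oracleFlip_involutive {n m w : ℕ} (addr : (Fin m → Bool) → Option (Fin n))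
    (X : BoolInput n) : Function.Involutive (oracleFlip (w := w) addr X) := by
  rintro ⟨i, b, z⟩
  unfold oracleFlip
  cases h : addr i <;> simp [h]

/-- The query operator `Q_X`, acting on amplitude vectors. Since `oracleFlip addr X` is its own
inverse, this is the linear extension of `|s⟩ ↦ |oracleFlip addr X s⟩`, a unitary map. -/
def queryOp {n m w : ℕ} (addr : (Fin m → Bool) → Option (Fin n)) (X : BoolInput n)
    (ψ : BasisState m w → ℂ) : BasisState m w → ℂ :=
  fun s => ψ (oracleFlip addr X s)

/-- A quantum query algorithm, with a single final measurement, for approximating the mean of `n`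
Boolean variables. -/
structure MeanQueryAlgorithm (n : ℕ) where
  /-- The number of queries `T`. -/
  queries : ℕ
  /-- The number of address qubits. -/
  addrQubits : ℕ
  /-- The number of workspace qubits. -/
  workQubits : ℕ
  /-- The coordinate of the input (if any) to which an address string refers. -/
  addr : (Fin addrQubits → Bool) → Option (Fin n)
  /-- The unitary transformations `U_0, ..., U_T`, which do not depend on the input (the members
  with larger index are never applied). -/
  U : ℕ → Matrix.unitaryGroup (BasisState addrQubits workQubits) ℂ
  /-- The initial state. -/
  init : BasisState addrQubits workQubits → ℂ
  init_unit : ∑ s, ‖init s‖ ^ 2 = 1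
  /-- The number `M` of outcomes of the measurement. -/
  outcomes : ℕ
  /-- The measurement operators of a general quantum measurement. -/
  meas : Fin outcomes → Matrix (BasisState addrQubits workQubits)
    (BasisState addrQubits workQubits) ℂ
  meas_complete : ∑ j, (meas j)ᴴ * meas j = 1
  /-- The approximation of the mean that is returned on outcome `j`. -/
  estimate : Fin outcomes → ℝ

namespace MeanQueryAlgorithm

variable {n : ℕ}

/-- The state `U_t Q_X U_{t-1} Q_X ⋯ U_1 Q_X U_0 |ψ_0⟩`. -/
def state (A : MeanQueryAlgorithm n) (X : BoolInput n) :
    ℕ → BasisState A.addrQubits A.workQubits → ℂ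
  | 0 => (A.U 0).1 *ᵥ A.init
  | t + 1 => (A.U (t + 1)).1 *ᵥ queryOp A.addr X (A.state X t)

/-- The final state, after `T` queries. -/
def finalState (A : MeanQueryAlgorithm n) (X : BoolInput n) :
    BasisState A.addrQubits A.workQubits → ℂ :=
  A.state X A.queries

/-- The probability `p_X(j) = ‖M_j ψ‖²` of outcome `j` on input `X`. -/
noncomputable def prob (A : MeanQueryAlgorithm n) (X : BoolInput n) (j : Fin A.outcomes) : ℝ :=
  ∑ s, ‖(A.meas j *ᵥ A.finalState X) s‖ ^ 2

/-- The expected error `(∑ j, |a_X - â(j)| ^ q * p_X(j)) ^ (1 / q)` on input `X`. -/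
noncomputable def expectedError (A : MeanQueryAlgorithm n) (q : ℝ) (X : BoolInput n) : ℝ :=
  (∑ j, |X.mean - A.estimate j| ^ q * A.prob X j) ^ (1 / q)

/-- The average, with respect to the probability measure `μ` on inputs, of the expected error. -/
noncomputable def avgExpectedError (A : MeanQueryAlgorithm n) (q : ℝ)
    (μ : PMF (BoolInput n)) : ℝ :=
  ∑ X, A.expectedError q X * (μ X).toReal

end MeanQueryAlgorithm

/-! Take a uniform `k`-set `S` and a uniform `d`-set `D` disjoint from it. The inputs with ones on
`S` and on `S ∪ D` have means `d / n` apart, and a query can separate their states only through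
amplitude on addresses naming `D`. Given `S`, the first state has average mass at most `d / (n - k)`
there. Given `Y = S ∪ D`, the set `D` is a uniform `d`-subset of `Y`, so the second has at most `d /
(k + d)`. For `k` and `k + d` in `I` both are at most `d / (α n)`, so after `T` queries the mean
squared distance is `O(T d / (α n))` (`expect_sqDist_le`).

Errors well below `d / n` on both inputs force the final states a constant apart
(`mean_sub_mean_le`), whence `T = Ω(α n / d)`. The hypothesis controls only the sum of the layer
errors over `I`, so the estimate is summed over all `k ∈ I` with `k + d ∈ I`
(`shift_le_of_sum_layerError_le`). Choosing `d ≈ 24 ε n / c`, rounded up to a positive integer,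
gives `min (ε⁻¹) n`; `ε = o(|I| / n)` leaves room for this shift inside `I`. -/

open scoped BigOperators

/-! ### Averages over subsets of fixed size -/

open Finset in
/-- Averaging, over the `d`-element subsets of `s`, the sum of `w` over the subset. -/
theorem expect_powersetCard_sum {ι : Type*} [DecidableEq ι] (s : Finset ι) {d : ℕ} (hd : 0 < d)
    (hds : d ≤ s.card) (w : ι → ℝ) :
    (𝔼 D ∈ s.powersetCard d, ∑ i ∈ D, w i) = (d : ℝ) / s.card * ∑ i ∈ s, w i := by
  have hsum : ∑ D ∈ s.powersetCard d, ∑ i ∈ D, w i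
      = ((s.card - 1).choose (d - 1) : ℝ) * ∑ i ∈ s, w i := by
    rw [Finset.sum_comm' (t' := s) (s' := fun i => (s.powersetCard d).filter (fun D => {i} ⊆ D)),
      Finset.mul_sum]
    · refine Finset.sum_congr rfl fun i hi => ?_
      rw [Finset.sum_const, card_filter_powersetCard_subset {i} s d (by simpa using hi)
        (by rw [card_singleton]; exact hd)]
      simp
    · intro D i
      simp only [mem_powersetCard, mem_filter, singleton_subset_iff]
      constructor
      · rintro ⟨⟨h1, h2⟩, h3⟩
        exact ⟨⟨⟨h1, h2⟩, h3⟩, h1 h3⟩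
      · rintro ⟨⟨⟨h1, h2⟩, h3⟩, -⟩
        exact ⟨⟨h1, h2⟩, h3⟩
  rw [expect_eq_sum_div_card, hsum, card_powersetCard]
  obtain ⟨e, rfl⟩ : ∃ e, d = e + 1 := ⟨d - 1, by omega⟩
  obtain ⟨m, hm⟩ : ∃ m, s.card = m + 1 := ⟨s.card - 1, by omega⟩
  have hpos : 0 < (m + 1).choose (e + 1) := Nat.choose_pos (by omega)
  have h : ((m + 1 : ℕ) : ℝ) * m.choose e = ((m + 1).choose (e + 1) : ℝ) * ((e + 1 : ℕ) : ℝ) := by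
    exact_mod_cast Nat.add_one_mul_choose_eq m e
  have hpos' : (0 : ℝ) < ((m + 1).choose (e + 1) : ℝ) := by exact_mod_cast hpos
  rw [hm]
  simp only [Nat.add_sub_cancel]
  have hm' : (0 : ℝ) < ((m + 1 : ℕ) : ℝ) := by positivity
  rw [div_mul_eq_mul_div, div_eq_div_iff hpos'.ne' hm'.ne']
  linear_combination (∑ i ∈ s, w i) * h

open Finset in
theorem expect_expect_eq_sum_div {ι κ : Type*} (s : Finset ι) (t : ι → Finset κ) (N : ℕ)
    (ht : ∀ i ∈ s, (t i).card = N) (f : ι → κ → ℝ) :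
    (𝔼 i ∈ s, 𝔼 j ∈ t i, f i j) = (∑ i ∈ s, ∑ j ∈ t i, f i j) / (s.card * N : ℕ) := by
  rw [expect_eq_sum_div_card, Nat.cast_mul, div_mul_eq_div_div_swap]
  congr 1
  rw [Finset.sum_div]
  refine Finset.sum_congr rfl fun i hi => ?_
  rw [expect_eq_sum_div_card, ht i hi]

open Finset in
/-- A uniform `k`-set `S` together with a uniform `d`-set `D` disjoint from it, versus a uniform
`(k + d)`-set `S ∪ D` with a uniform `d`-subset `D`. -/
theorem expect_powersetCard_union {ι : Type*} [Fintype ι] [DecidableEq ι] (k d : ℕ)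
    (f : Finset ι → Finset ι → ℝ) :
    (𝔼 S ∈ (univ : Finset ι).powersetCard k, 𝔼 D ∈ Sᶜ.powersetCard d, f (S ∪ D) D)
      = 𝔼 Y ∈ (univ : Finset ι).powersetCard (k + d), 𝔼 D ∈ Y.powersetCard d, f Y D := by
  rw [expect_expect_eq_sum_div _ _ ((Fintype.card ι - k).choose d),
    expect_expect_eq_sum_div _ _ ((k + d).choose d)]
  · congr 1
    · rw [Finset.sum_sigma', Finset.sum_sigma']
      refine Finset.sum_bij' (fun p _ => ⟨p.1 ∪ p.2, p.2⟩) (fun p _ => ⟨p.1 \ p.2, p.2⟩)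
        ?_ ?_ ?_ ?_ ?_
      · rintro ⟨S, D⟩ h
        simp only [mem_sigma, mem_powersetCard, subset_univ, true_and] at h ⊢
        obtain ⟨h1, h2, h3⟩ := h
        refine ⟨?_, subset_union_right, h3⟩
        rw [card_union_of_disjoint (subset_compl_iff_disjoint_left.1 h2), h1, h3]
      · rintro ⟨Y, D⟩ h
        simp only [mem_sigma, mem_powersetCard, subset_univ, true_and] at h ⊢
        obtain ⟨h1, h2, h3⟩ := h
        refine ⟨?_, subset_compl_iff_disjoint_left.2 sdiff_disjoint, h3⟩
        rw [card_sdiff_of_subset h2, h1, h3]; omega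
      · rintro ⟨S, D⟩ h
        simp only [mem_sigma, mem_powersetCard, subset_univ, true_and] at h ⊢
        rw [union_sdiff_cancel_right (subset_compl_iff_disjoint_left.1 h.2.1)]
      · rintro ⟨Y, D⟩ h
        simp only [mem_sigma, mem_powersetCard, subset_univ, true_and] at h ⊢
        rw [sdiff_union_of_subset h.2.1]
      · rintro ⟨S, D⟩ h
        rfl
    · rw [card_powersetCard, card_powersetCard, card_univ]
      congr 1
      rcases le_or_gt (k + d) (Fintype.card ι) with h | h
      · have := Nat.choose_mul (n := Fintype.card ι) (k := k + d) (s := k) (by omega)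
        rw [Nat.add_sub_cancel_left, Nat.choose_symm_add] at this
        exact this.symm
      -- If `k + d` exceeds the size of the ground set, both counts vanish, so no bound on `k + d`
      -- is needed.
      · rw [Nat.choose_eq_zero_of_lt h, zero_mul]
        rcases Nat.lt_or_ge (Fintype.card ι) k with h' | h'
        · rw [Nat.choose_eq_zero_of_lt h', zero_mul]
        · rw [Nat.choose_eq_zero_of_lt (by omega : Fintype.card ι - k < d), mul_zero]
  · intro Y hY
    rw [card_powersetCard, (mem_powersetCard.1 hY).2]
  · intro S hS
    rw [card_powersetCard, card_compl, (mem_powersetCard.1 hS).2]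

/-! ### Norms under measurements and unitaries -/

theorem norm_add_sq_le_two_mul {E : Type*} [SeminormedAddCommGroup E] (a b : E) :
    ‖a + b‖ ^ 2 ≤ 2 * ‖a‖ ^ 2 + 2 * ‖b‖ ^ 2 := by
  have h := norm_add_le a b
  nlinarith [sq_nonneg (‖a‖ - ‖b‖), norm_nonneg (a + b), norm_nonneg a, norm_nonneg b]

theorem sum_norm_sq_mulVec {ι κ : Type*} [Fintype ι] [DecidableEq ι] [Fintype κ]
    (M : κ → Matrix ι ι ℂ) (hM : ∑ j, (M j)ᴴ * M j = 1) (v : ι → ℂ) :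
    ∑ j, ∑ s, ‖(M j *ᵥ v) s‖ ^ 2 = ∑ s, ‖v s‖ ^ 2 := by
  have key : ∀ u : ι → ℂ, ((∑ s, ‖u s‖ ^ 2 : ℝ) : ℂ) = star u ⬝ᵥ u := by
    intro u
    rw [dotProduct, Complex.ofReal_sum]
    refine Finset.sum_congr rfl fun s _ => ?_
    rw [Pi.star_apply, Complex.star_def, Complex.conj_mul', Complex.ofReal_pow]
  apply Complex.ofReal_injective
  rw [Complex.ofReal_sum, key]
  calc ∑ j, ((∑ s, ‖(M j *ᵥ v) s‖ ^ 2 : ℝ) : ℂ)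
      = ∑ j, star v ⬝ᵥ (((M j)ᴴ * M j) *ᵥ v) := by
        refine Finset.sum_congr rfl fun j _ => ?_
        rw [key, Matrix.star_mulVec, ← Matrix.dotProduct_mulVec, Matrix.mulVec_mulVec]
    _ = star v ⬝ᵥ v := by
        rw [← dotProduct_sum, ← Matrix.sum_mulVec, hM, Matrix.one_mulVec]

theorem sum_norm_sq_unitary_mulVec {ι : Type*} [Fintype ι] [DecidableEq ι]
    (U : Matrix.unitaryGroup ι ℂ) (v : ι → ℂ) :
    ∑ s, ‖(U.1 *ᵥ v) s‖ ^ 2 = ∑ s, ‖v s‖ ^ 2 := by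
  have h := sum_norm_sq_mulVec (fun _ : Unit => U.1)
    (by simpa [Matrix.star_eq_conjTranspose] using Matrix.UnitaryGroup.star_mul_self U) v
  simpa using h

/-! ### The effect of one query -/

theorem oracleFlip_fst {n m w : ℕ} (addr : (Fin m → Bool) → Option (Fin n)) (X : BoolInput n)
    (s : BasisState m w) : (oracleFlip addr X s).1 = s.1 := by
  unfold oracleFlip
  split <;> rfl

theorem sum_comp_oracleFlip {n m w : ℕ} (addr : (Fin m → Bool) → Option (Fin n)) (X : BoolInput n)
    (g : BasisState m w → ℝ) : ∑ s, g (oracleFlip addr X s) = ∑ s, g s :=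
  Equiv.sum_comp ((oracleFlip_involutive addr X).toPerm) g

/-- The squared norm of the part of `φ` whose address names the coordinate `i`. -/
noncomputable def queryMass {n m w : ℕ} (addr : (Fin m → Bool) → Option (Fin n))
    (φ : BasisState m w → ℂ) (i : Fin n) : ℝ :=
  ∑ s, if addr s.1 = some i then ‖φ s‖ ^ 2 else 0

theorem queryMass_nonneg {n m w : ℕ} (addr : (Fin m → Bool) → Option (Fin n))
    (φ : BasisState m w → ℂ) (i : Fin n) : 0 ≤ queryMass addr φ i :=
  Finset.sum_nonneg fun s _ => by split_ifs <;> positivity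

/-- Each address names at most one coordinate; addresses naming none account for the loss. -/
theorem sum_queryMass_le {n m w : ℕ} (addr : (Fin m → Bool) → Option (Fin n))
    (φ : BasisState m w → ℂ) : ∑ i, queryMass addr φ i ≤ ∑ s, ‖φ s‖ ^ 2 := by
  unfold queryMass
  rw [Finset.sum_comm]
  refine Finset.sum_le_sum fun s _ => ?_
  rcases h : addr s.1 with _ | i
  · simp
  · simp

/-- One query to inputs that differ only within `D` increases the squared distance by at most
twice the mass that the two states put on `D`. -/
theorem sum_norm_sq_queryOp_sub_le {n m w : ℕ} (addr : (Fin m → Bool) → Option (Fin n))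
    (X Y : BoolInput n) (D : Finset (Fin n)) (hD : ∀ i, i ∉ D → X i = Y i)
    (φ χ : BasisState m w → ℂ) :
    ∑ s, ‖queryOp addr X φ s - queryOp addr Y χ s‖ ^ 2
      ≤ ∑ s, ‖φ s - χ s‖ ^ 2
        + 2 * ∑ i ∈ D, (queryMass addr φ i + queryMass addr χ i) := by
  let r : (BasisState m w → ℂ) → BasisState m w → ℝ :=
    fun u s => ∑ i ∈ D, if addr s.1 = some i then ‖u s‖ ^ 2 else 0
  have hr : ∀ u : BasisState m w → ℂ, ∑ s, r u s = ∑ i ∈ D, queryMass addr u i :=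
    fun u => Finset.sum_comm
  have hr0 : ∀ u s, 0 ≤ r u s :=
    fun u s => Finset.sum_nonneg fun i _ => by split_ifs <;> positivity
  have hpt : ∀ s, ‖queryOp addr X φ s - queryOp addr Y χ s‖ ^ 2
      ≤ ‖φ (oracleFlip addr X s) - χ (oracleFlip addr X s)‖ ^ 2
        + 2 * (r φ (oracleFlip addr X s) + r χ (oracleFlip addr Y s)) := by
    intro s
    have h1 := hr0 φ (oracleFlip addr X s)
    have h2 := hr0 χ (oracleFlip addr Y s)
    -- On addresses naming `D` the two amplitudes are bounded separately; on all others the two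
    -- oracles move `s` identically.
    by_cases hs : ∃ i ∈ D, addr s.1 = some i
    · obtain ⟨i, hi, his⟩ := hs
      have hr1 : ∀ (u : BasisState m w → ℂ) (Z : BoolInput n),
          r u (oracleFlip addr Z s) = ‖u (oracleFlip addr Z s)‖ ^ 2 := by
        intro u Z
        simp [r, oracleFlip_fst, his, hi]
      rw [hr1, hr1]
      have h3 := norm_add_sq_le_two_mul (φ (oracleFlip addr X s)) (-χ (oracleFlip addr Y s))
      rw [norm_neg, ← sub_eq_add_neg] at h3
      have h4 := sq_nonneg ‖φ (oracleFlip addr X s) - χ (oracleFlip addr X s)‖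
      unfold queryOp
      linarith
    · have heq : oracleFlip addr Y s = oracleFlip addr X s := by
        unfold oracleFlip
        split
        · rename_i i h
          rw [hD i fun hi => hs ⟨i, hi, h⟩]
        · rfl
      unfold queryOp
      rw [heq] at h2 ⊢
      linarith
  refine (Finset.sum_le_sum fun s _ => hpt s).trans_eq ?_
  rw [Finset.sum_add_distrib, ← Finset.mul_sum, Finset.sum_add_distrib,
    sum_comp_oracleFlip addr X (fun s => ‖φ s - χ s‖ ^ 2), sum_comp_oracleFlip addr X (r φ),
    sum_comp_oracleFlip addr Y (r χ), hr, hr, Finset.sum_add_distrib]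

/-- The input whose set of ones is `S`. -/
def BoolInput.ofFinset {n : ℕ} (S : Finset (Fin n)) : BoolInput n := fun i => decide (i ∈ S)

theorem BoolInput.weight_ofFinset {n : ℕ} (S : Finset (Fin n)) :
    (BoolInput.ofFinset S).weight = S.card := by
  have h : ∀ i, (BoolInput.ofFinset S i).toNat = if i ∈ S then 1 else 0 := by
    intro i
    by_cases hi : i ∈ S <;> simp [BoolInput.ofFinset, hi]
  simp [BoolInput.weight, h]

theorem BoolInput.ofFinset_bijective (n : ℕ) :
    Function.Bijective (BoolInput.ofFinset : Finset (Fin n) → BoolInput n) := by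
  constructor
  · intro S T h
    ext i
    simpa [BoolInput.ofFinset] using congrFun h i
  · intro X
    refine ⟨Finset.univ.filter fun i => X i = true, ?_⟩
    funext i
    simp [BoolInput.ofFinset]

/-! ### Growth of the distance between states -/

namespace MeanQueryAlgorithm

variable {n : ℕ}

theorem sum_norm_sq_state (A : MeanQueryAlgorithm n) (X : BoolInput n) (t : ℕ) :
    ∑ s, ‖A.state X t s‖ ^ 2 = 1 := by
  induction t with
  | zero => rw [state, sum_norm_sq_unitary_mulVec, A.init_unit]
  | succ t ih =>
    rw [state, sum_norm_sq_unitary_mulVec, ← ih]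
    exact sum_comp_oracleFlip A.addr X (fun s => ‖A.state X t s‖ ^ 2)

/-- The squared distance of the states reached after `t` queries on the inputs `X` and `Y`. -/
noncomputable def sqDist (A : MeanQueryAlgorithm n) (X Y : BoolInput n) (t : ℕ) : ℝ :=
  ∑ s, ‖A.state X t s - A.state Y t s‖ ^ 2

theorem sqDist_zero (A : MeanQueryAlgorithm n) (X Y : BoolInput n) : A.sqDist X Y 0 = 0 := by
  simp [sqDist, state]

theorem sqDist_succ_le (A : MeanQueryAlgorithm n) (X Y : BoolInput n) (D : Finset (Fin n))
    (hD : ∀ i, i ∉ D → X i = Y i) (t : ℕ) :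
    A.sqDist X Y (t + 1) ≤ A.sqDist X Y t
      + 2 * ∑ i ∈ D, (queryMass A.addr (A.state X t) i + queryMass A.addr (A.state Y t) i) := by
  refine le_trans (le_of_eq ?_) (sum_norm_sq_queryOp_sub_le A.addr X Y D hD _ _)
  have h := sum_norm_sq_unitary_mulVec (A.U (t + 1))
    (queryOp A.addr X (A.state X t) - queryOp A.addr Y (A.state Y t))
  rw [Matrix.mulVec_sub] at h
  exact h

theorem sum_queryMass_state_le (A : MeanQueryAlgorithm n) (X : BoolInput n) (t : ℕ)
    (S : Finset (Fin n)) : ∑ i ∈ S, queryMass A.addr (A.state X t) i ≤ 1 := by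
  rw [← A.sum_norm_sq_state X t]
  exact (Finset.sum_le_univ_sum_of_nonneg (queryMass_nonneg _ _)).trans (sum_queryMass_le _ _)

-- The state is fixed while `D` varies, so a random `D` catches a `d / |S|` share of a total mass of
-- at most 1.
open Finset in
theorem expect_queryMass_le (A : MeanQueryAlgorithm n) (X : BoolInput n) (t : ℕ)
    (S : Finset (Fin n)) {d : ℕ} (hd : 0 < d) (hdS : d ≤ S.card) :
    (𝔼 D ∈ S.powersetCard d, ∑ i ∈ D, queryMass A.addr (A.state X t) i) ≤ (d : ℝ) / S.card := by
  rw [expect_powersetCard_sum S hd hdS]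
  exact mul_le_of_le_one_right (by positivity) (A.sum_queryMass_state_le X t S)

open Finset BoolInput in
/-- The average squared distance between the states on a random input of weight `k` and on a
random input of weight `k + d` above it grows linearly with the number of queries. -/
theorem expect_sqDist_le (A : MeanQueryAlgorithm n) {k d : ℕ} (hd : 0 < d) (hkd : k + d ≤ n)
    (t : ℕ) :
    (𝔼 S ∈ (univ : Finset (Fin n)).powersetCard k, 𝔼 D ∈ Sᶜ.powersetCard d,
      A.sqDist (ofFinset S) (ofFinset (S ∪ D)) t)
      ≤ t * (2 * ((d : ℝ) / (n - k : ℕ) + (d : ℝ) / (k + d : ℕ))) := by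
  induction t with
  | zero => simp [sqDist_zero]
  | succ t ih =>
    have hne : ∀ m ≤ n, ((univ : Finset (Fin n)).powersetCard m).Nonempty := fun m hm => by
      rw [powersetCard_nonempty]; simpa using hm
    have hX : (𝔼 S ∈ (univ : Finset (Fin n)).powersetCard k, 𝔼 D ∈ Sᶜ.powersetCard d,
        ∑ i ∈ D, queryMass A.addr (A.state (ofFinset S) t) i) ≤ (d : ℝ) / (n - k : ℕ) := by
      refine expect_le (hne k (by omega)) fun S hS => ?_
      have hc : Sᶜ.card = n - k := by
        rw [card_compl, (mem_powersetCard.1 hS).2, Fintype.card_fin]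
      have h := A.expect_queryMass_le (ofFinset S) t Sᶜ hd (by omega)
      rwa [hc] at h
    have hY : (𝔼 S ∈ (univ : Finset (Fin n)).powersetCard k, 𝔼 D ∈ Sᶜ.powersetCard d,
        ∑ i ∈ D, queryMass A.addr (A.state (ofFinset (S ∪ D)) t) i)
          ≤ (d : ℝ) / (k + d : ℕ) := by
      -- This state depends on `D` through `S ∪ D`; averaging over `Y = S ∪ D` first makes it
      -- independent of `D`.
      rw [expect_powersetCard_union k d
        (fun Y D => ∑ i ∈ D, queryMass A.addr (A.state (ofFinset Y) t) i)]
      refine expect_le (hne _ hkd) fun Y hY => ?_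
      have hc := (mem_powersetCard.1 hY).2
      have h := A.expect_queryMass_le (ofFinset Y) t Y hd (by omega)
      rwa [hc] at h
    have hstep : (𝔼 S ∈ (univ : Finset (Fin n)).powersetCard k, 𝔼 D ∈ Sᶜ.powersetCard d,
        A.sqDist (ofFinset S) (ofFinset (S ∪ D)) (t + 1))
        ≤ 𝔼 S ∈ (univ : Finset (Fin n)).powersetCard k, 𝔼 D ∈ Sᶜ.powersetCard d,
          (A.sqDist (ofFinset S) (ofFinset (S ∪ D)) t
            + 2 * ((∑ i ∈ D, queryMass A.addr (A.state (ofFinset S) t) i)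
              + ∑ i ∈ D, queryMass A.addr (A.state (ofFinset (S ∪ D)) t) i)) := by
      refine expect_le_expect fun S _ => expect_le_expect fun D _ => ?_
      rw [← sum_add_distrib]
      refine A.sqDist_succ_le _ _ D (fun i hi => ?_) t
      simp [ofFinset, hi]
    simp only [expect_add_distrib, ← mul_expect] at hstep
    push_cast at *
    linarith

/-! ### Small error forces distant final states -/

theorem sum_prob (A : MeanQueryAlgorithm n) (X : BoolInput n) : ∑ j, A.prob X j = 1 := by
  unfold prob
  rw [sum_norm_sq_mulVec A.meas A.meas_complete, finalState, sum_norm_sq_state]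

theorem prob_nonneg (A : MeanQueryAlgorithm n) (X : BoolInput n) (j : Fin A.outcomes) :
    0 ≤ A.prob X j :=
  Finset.sum_nonneg fun _ _ => by positivity

/-- The expected absolute error on input `X`. -/
noncomputable def absError (A : MeanQueryAlgorithm n) (X : BoolInput n) : ℝ :=
  ∑ j, |X.mean - A.estimate j| * A.prob X j

theorem absError_nonneg (A : MeanQueryAlgorithm n) (X : BoolInput n) : 0 ≤ A.absError X :=
  Finset.sum_nonneg fun j _ => mul_nonneg (abs_nonneg _) (A.prob_nonneg X j)

/-- The power mean inequality reduces every `q ≥ 1` to the case `q = 1`. -/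
theorem absError_le_expectedError (A : MeanQueryAlgorithm n) {q : ℝ} (hq : 1 ≤ q)
    (X : BoolInput n) : A.absError X ≤ A.expectedError q X := by
  have h := Real.arith_mean_le_rpow_mean Finset.univ (A.prob X)
    (fun j => |X.mean - A.estimate j|) (fun j _ => A.prob_nonneg X j) (A.sum_prob X)
    (fun j _ => abs_nonneg _) hq
  simpa only [absError, expectedError, mul_comm] using h

/-- Split `M_j ψ_Y = M_j ψ_X + M_j (ψ_Y - ψ_X)`; by completeness the last terms have total squared
norm equal to the squared distance. -/
theorem sum_prob_le (A : MeanQueryAlgorithm n) (X Y : BoolInput n)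
    (S : Finset (Fin A.outcomes)) :
    ∑ j ∈ S, A.prob Y j ≤ 2 * ∑ j ∈ S, A.prob X j + 2 * A.sqDist X Y A.queries := by
  let v := A.finalState Y - A.finalState X
  have hv : ∑ j, ∑ s, ‖(A.meas j *ᵥ v) s‖ ^ 2 = A.sqDist X Y A.queries := by
    rw [sum_norm_sq_mulVec A.meas A.meas_complete]
    exact Finset.sum_congr rfl fun s _ => by rw [← norm_sub_rev]; rfl
  have hS : ∑ j ∈ S, ∑ s, ‖(A.meas j *ᵥ v) s‖ ^ 2 ≤ A.sqDist X Y A.queries := by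
    rw [← hv]
    exact Finset.sum_le_univ_sum_of_nonneg fun j => Finset.sum_nonneg fun _ _ => by positivity
  have hj : ∀ j, A.prob Y j ≤ 2 * A.prob X j + 2 * ∑ s, ‖(A.meas j *ᵥ v) s‖ ^ 2 := by
    intro j
    unfold prob
    rw [Finset.mul_sum, Finset.mul_sum, ← Finset.sum_add_distrib]
    refine Finset.sum_le_sum fun s _ => ?_
    have h := norm_add_sq_le_two_mul ((A.meas j *ᵥ A.finalState X) s) ((A.meas j *ᵥ v) s)
    have hadd : (A.meas j *ᵥ A.finalState X) s + (A.meas j *ᵥ v) s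
        = (A.meas j *ᵥ A.finalState Y) s := by
      rw [← Pi.add_apply, ← Matrix.mulVec_add, add_sub_cancel]
    rwa [hadd] at h
  have h := Finset.sum_le_sum fun j (_ : j ∈ S) => hj j
  rw [Finset.sum_add_distrib, ← Finset.mul_sum, ← Finset.mul_sum] at h
  linarith

/-- Markov's inequality for the absolute error. -/
theorem mul_sum_prob_le_absError (A : MeanQueryAlgorithm n) (X : BoolInput n) (δ : ℝ)
    (S : Finset (Fin A.outcomes)) (hS : ∀ j ∈ S, δ ≤ |X.mean - A.estimate j|) :
    δ * ∑ j ∈ S, A.prob X j ≤ A.absError X := by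
  rw [Finset.mul_sum]
  refine (Finset.sum_le_sum fun j hj =>
    mul_le_mul_of_nonneg_right (hS j hj) (A.prob_nonneg X j)).trans ?_
  exact Finset.sum_le_univ_sum_of_nonneg fun j => mul_nonneg (abs_nonneg _) (A.prob_nonneg X j)

open Finset in
/-- An algorithm with small error on two inputs has to separate their final states. -/
theorem mean_sub_mean_le (A : MeanQueryAlgorithm n) (X Y : BoolInput n)
    (h : X.mean ≤ Y.mean) :
    Y.mean - X.mean ≤ 4 * A.absError X + 2 * A.absError Y
      + 2 * (Y.mean - X.mean) * A.sqDist X Y A.queries := by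
  -- Outcomes in `S` are at least half the gap away from the mean of `X`; by the triangle inequality
  -- those outside `S` are that far from the mean of `Y`. Markov applies to both.
  set S : Finset (Fin A.outcomes) :=
    univ.filter fun j => (Y.mean - X.mean) / 2 ≤ |X.mean - A.estimate j| with hS
  have hX := A.mul_sum_prob_le_absError X ((Y.mean - X.mean) / 2) S
    fun j hj => (mem_filter.1 hj).2
  have hY := A.mul_sum_prob_le_absError Y ((Y.mean - X.mean) / 2) Sᶜ fun j hj => by
    rw [hS, mem_compl, mem_filter, not_and, not_le] at hj
    have h1 := hj (mem_univ j)
    have h2 := abs_sub_le Y.mean (A.estimate j) X.mean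
    rw [abs_sub_comm (A.estimate j)] at h2
    have h3 := le_abs_self (Y.mean - X.mean)
    linarith
  have hsum : ∑ j ∈ S, A.prob Y j + ∑ j ∈ Sᶜ, A.prob Y j = 1 := by
    rw [sum_add_sum_compl, sum_prob]
  have hd := mul_le_mul_of_nonneg_left (A.sum_prob_le X Y S) (sub_nonneg.2 h)
  have hs : (Y.mean - X.mean) * ∑ j ∈ S, A.prob Y j
      + (Y.mean - X.mean) * ∑ j ∈ Sᶜ, A.prob Y j = Y.mean - X.mean := by
    rw [← mul_add, hsum, mul_one]
  linarith

/-! ### Errors averaged over weight layers -/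

open Finset in
/-- The average of the expected absolute error over all inputs of weight `k`. -/
noncomputable def layerError (A : MeanQueryAlgorithm n) (k : ℕ) : ℝ :=
  𝔼 S ∈ (univ : Finset (Fin n)).powersetCard k, A.absError (BoolInput.ofFinset S)

theorem layerError_nonneg (A : MeanQueryAlgorithm n) (k : ℕ) : 0 ≤ A.layerError k :=
  Finset.expect_nonneg fun _ _ => A.absError_nonneg _

open Finset BoolInput in
/-- Distinguishing weight `k` from weight `k + d` requires many queries. -/
theorem div_le_layerError (A : MeanQueryAlgorithm n) {k d : ℕ} (hd : 0 < d) (hkd : k + d ≤ n) :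
    (d : ℝ) / n ≤ 4 * A.layerError k + 2 * A.layerError (k + d)
      + 2 * ((d : ℝ) / n)
        * (A.queries * (2 * ((d : ℝ) / (n - k : ℕ) + (d : ℝ) / (k + d : ℕ)))) := by
  have hne : ((univ : Finset (Fin n)).powersetCard k).Nonempty := by
    rw [powersetCard_nonempty]; simp; omega
  have hne' : ∀ S ∈ (univ : Finset (Fin n)).powersetCard k, (Sᶜ.powersetCard d).Nonempty := by
    intro S hS
    rw [powersetCard_nonempty, card_compl, (mem_powersetCard.1 hS).2, Fintype.card_fin]; omega
  have hX : (𝔼 S ∈ (univ : Finset (Fin n)).powersetCard k, 𝔼 D ∈ Sᶜ.powersetCard d,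
      A.absError (ofFinset S)) = A.layerError k :=
    expect_congr rfl fun S hS => expect_const (hne' S hS) _
  have hY : (𝔼 S ∈ (univ : Finset (Fin n)).powersetCard k, 𝔼 D ∈ Sᶜ.powersetCard d,
      A.absError (ofFinset (S ∪ D))) = A.layerError (k + d) := by
    rw [expect_powersetCard_union k d (fun Y _ => A.absError (ofFinset Y))]
    refine expect_congr rfl fun Y hY => expect_const ?_ _
    rw [powersetCard_nonempty, (mem_powersetCard.1 hY).2]; omega
  have hpt : (d : ℝ) / n ≤ 𝔼 S ∈ (univ : Finset (Fin n)).powersetCard k,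
      𝔼 D ∈ Sᶜ.powersetCard d, (4 * A.absError (ofFinset S) + 2 * A.absError (ofFinset (S ∪ D))
        + 2 * ((d : ℝ) / n) * A.sqDist (ofFinset S) (ofFinset (S ∪ D)) A.queries) := by
    refine le_expect hne fun S hS => le_expect (hne' S hS) fun D hD => ?_
    have hmean : (ofFinset (S ∪ D)).mean - (ofFinset S).mean = (d : ℝ) / n := by
      have hdisj := subset_compl_iff_disjoint_left.1 (mem_powersetCard.1 hD).1
      rw [mean, mean, weight_ofFinset, weight_ofFinset, card_union_of_disjoint hdisj,
        (mem_powersetCard.1 hD).2]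
      push_cast
      ring
    have h := A.mean_sub_mean_le (ofFinset S) (ofFinset (S ∪ D))
      (sub_nonneg.1 (hmean ▸ by positivity))
    rwa [hmean] at h
  simp only [expect_add_distrib, ← mul_expect] at hpt
  rw [hX, hY] at hpt
  have hdist := mul_le_mul_of_nonneg_left (A.expect_sqDist_le hd hkd A.queries)
    (by positivity : (0 : ℝ) ≤ 2 * ((d : ℝ) / n))
  linarith

-- Grouping inputs by weight, the lower bound on `μ` gives each layer in `I` at least `b` times its
-- uniform distribution.
open Finset BoolInput in
theorem sum_layerError_le_avgExpectedError (A : MeanQueryAlgorithm n) {q : ℝ} (hq : 1 ≤ q)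
    (μ : PMF (BoolInput n)) (I : Finset ℕ) {b : ℝ}
    (hμ : ∀ X : BoolInput n, X.weight ∈ I → b * (1 / (n.choose X.weight : ℝ)) ≤ (μ X).toReal) :
    b * ∑ k ∈ I, A.layerError k ≤ A.avgExpectedError q μ := by
  have h1 : ∑ S ∈ univ.filter (fun S : Finset (Fin n) => S.card ∈ I),
      A.absError (ofFinset S) * (μ (ofFinset S)).toReal ≤ A.avgExpectedError q μ := by
    unfold avgExpectedError
    rw [← (ofFinset_bijective n).sum_comp (fun X => A.expectedError q X * (μ X).toReal)]
    refine (sum_le_univ_sum_of_nonneg fun S =>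
      mul_nonneg (A.absError_nonneg _) ENNReal.toReal_nonneg).trans ?_
    exact sum_le_sum fun S _ => mul_le_mul_of_nonneg_right
      (A.absError_le_expectedError hq _) ENNReal.toReal_nonneg
  refine le_trans ?_ h1
  rw [← sum_fiberwise_of_maps_to (g := Finset.card) (t := I) (fun S hS => (mem_filter.1 hS).2),
    mul_sum]
  refine sum_le_sum fun k hk => ?_
  have hset : (univ.filter (fun S : Finset (Fin n) => S.card ∈ I)).filter (fun S => S.card = k)
      = (univ : Finset (Fin n)).powersetCard k := by
    ext S
    simp only [mem_filter, mem_univ, true_and, mem_powersetCard, subset_univ]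
    exact ⟨fun h => h.2, fun h => ⟨h ▸ hk, h⟩⟩
  rw [hset, layerError, expect_eq_sum_div_card, card_powersetCard, card_univ, Fintype.card_fin,
    sum_div, mul_sum]
  refine sum_le_sum fun S hS => ?_
  have hc := (mem_powersetCard.1 hS).2
  have h := hμ (ofFinset S) (by rw [weight_ofFinset, hc]; exact hk)
  rw [weight_ofFinset, hc] at h
  refine le_trans (le_of_eq ?_) (mul_le_mul_of_nonneg_left h (A.absError_nonneg (ofFinset S)))
  ring

end MeanQueryAlgorithm

/-! ### Summation over the interval and choice of the shift -/

/-- In a finite set of consecutive naturals, at most `d` elements leave the set when shifted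
by `d`. -/
theorem Finset.card_le_card_filter_add_mem {I : Finset ℕ} (hI : (I : Set ℕ).OrdConnected)
    (d : ℕ) : I.card ≤ (I.filter fun k => k + d ∈ I).card + d := by
  rcases I.eq_empty_or_nonempty with rfl | hne
  · simp
  -- Elements whose shift leaves `I` lie within `d` of its maximum, since `I` has no gaps.
  have hsub : I.filter (fun k => ¬ k + d ∈ I) ⊆
      Finset.Ico (I.max' hne + 1 - d) (I.max' hne + 1) := by
    intro k hk
    rw [mem_filter] at hk
    have h1 := I.le_max' k hk.1
    rw [mem_Ico]
    refine ⟨?_, by omega⟩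
    by_contra! h
    exact hk.2 (hI.out hk.1 (I.max'_mem hne) ⟨by omega, by omega⟩)
  have h := Finset.card_le_card hsub
  rw [Nat.card_Ico] at h
  have := Finset.card_filter_add_card_filter_not (s := I) (fun k => k + d ∈ I)
  omega

open Finset in
/-- The lower bound for a single `n`: `δ` bounds the mean layer error over the interval `I`, and
the shift `d` is at most half its length. -/
theorem MeanQueryAlgorithm.shift_le_of_sum_layerError_le {n : ℕ} (hn : 0 < n)
    (A : MeanQueryAlgorithm n) {I : Finset ℕ} (hIn : I ⊆ Icc 0 n) (hI : (I : Set ℕ).OrdConnected) (hne : I.Nonempty)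
    {α : ℝ} (hα : 0 < α) (hk : ∀ k ∈ I, α * (n : ℝ) ^ 2 ≤ (k : ℝ) * ((n : ℝ) - k))
    {d : ℕ} (hd : 0 < d) (hdI : 2 * d ≤ I.card) {δ : ℝ}
    (hδ : ∑ k ∈ I, A.layerError k ≤ I.card * δ) :
    (d : ℝ) ≤ 12 * n * δ + 8 * A.queries * d ^ 2 / (α * n) := by
  have hn' : (0 : ℝ) < n := by exact_mod_cast hn
  set J := I.filter fun k => k + d ∈ I with hJ
  have hcard : I.card ≤ 2 * J.card := by
    have := card_le_card_filter_add_mem hI d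
    rw [← hJ] at this
    omega
  have hcard' : (I.card : ℝ) ≤ 2 * J.card := by exact_mod_cast hcard
  have hpos : (0 : ℝ) < J.card := by
    have : 0 < I.card := hne.card_pos
    exact_mod_cast (by omega : 0 < J.card)
  have hlow : ∀ k ∈ I, k ≤ n ∧ α * n ≤ k ∧ α * n ≤ ((n - k : ℕ) : ℝ) := by
    intro k hkI
    have hkn : k ≤ n := (mem_Icc.1 (hIn hkI)).2
    have hkn' : (k : ℝ) ≤ n := by exact_mod_cast hkn
    have hk0 : (0 : ℝ) ≤ k := Nat.cast_nonneg k
    have h := hk k hkI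
    -- In `k (n - k) ≥ α n²` bound either factor by `n`; the other is then at least `α n`.
    refine ⟨hkn, le_of_mul_le_mul_right (a := (n : ℝ)) ?_ hn',
      le_of_mul_le_mul_right (a := (n : ℝ)) ?_ hn'⟩
    · nlinarith
    · rw [Nat.cast_sub hkn]
      nlinarith
  set E : ℝ := 8 * A.queries * d ^ 2 / (α * n) with hE
  have hαn : 0 < α * n := by positivity
  have hstep : ∀ k ∈ J, (d : ℝ) / n
      ≤ 4 * A.layerError k + 2 * A.layerError (k + d) + E / n := by
    intro k hkJ
    obtain ⟨hkI, hkdI⟩ := mem_filter.1 hkJ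
    refine (A.div_le_layerError hd (hlow _ hkdI).1).trans (add_le_add_right ?_ _)
    have h1 : (d : ℝ) / (n - k : ℕ) ≤ d / (α * n) :=
      div_le_div_of_nonneg_left (by positivity) hαn (hlow k hkI).2.2
    have h2 : (d : ℝ) / (k + d : ℕ) ≤ d / (α * n) :=
      div_le_div_of_nonneg_left (by positivity) hαn (hlow _ hkdI).2.1
    calc 2 * ((d : ℝ) / n) * (A.queries * (2 * ((d : ℝ) / (n - k : ℕ) + (d : ℝ) / (k + d : ℕ))))
        ≤ 2 * ((d : ℝ) / n) * (A.queries * (2 * (d / (α * n) + d / (α * n)))) := by gcongr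
      _ = E / n := by rw [hE]; ring
  have hsum := sum_le_sum hstep
  rw [sum_const, nsmul_eq_mul, sum_add_distrib, sum_add_distrib, ← mul_sum, ← mul_sum, sum_const,
    nsmul_eq_mul] at hsum
  have h1 : ∑ k ∈ J, A.layerError k ≤ ∑ k ∈ I, A.layerError k :=
    sum_le_sum_of_subset_of_nonneg (filter_subset _ _) fun k _ _ => A.layerError_nonneg k
  have h2 : ∑ k ∈ J, A.layerError (k + d) ≤ ∑ k ∈ I, A.layerError k := by
    rw [← sum_image (f := A.layerError) (g := fun k => k + d) (by intro a _ b _ h; simpa using h)]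
    refine sum_le_sum_of_subset_of_nonneg ?_ fun k _ _ => A.layerError_nonneg k
    intro m hm
    obtain ⟨k, hkJ, rfl⟩ := mem_image.1 hm
    exact (mem_filter.1 hkJ).2
  have hδ0 : 0 ≤ δ := by
    have : (0 : ℝ) < I.card := by exact_mod_cast hne.card_pos
    have h0 : 0 ≤ ∑ k ∈ I, A.layerError k := sum_nonneg fun k _ => A.layerError_nonneg k
    exact nonneg_of_mul_nonneg_right (h0.trans hδ) this
  have h3 := mul_le_mul_of_nonneg_right hcard' hδ0
  -- The layer errors enter with weight `4 + 2 = 6`, and `|I| ≤ 2 |J|` turns this into `12`.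
  have h4 : (J.card : ℝ) * (d / n) ≤ J.card * (12 * δ + E / n) := by linarith
  have h5 := mul_le_mul_of_nonneg_right (le_of_mul_le_mul_left h4 hpos) hn'.le
  rw [div_mul_cancel₀ _ hn'.ne', add_mul, div_mul_cancel₀ _ hn'.ne'] at h5
  linarith

/-- The constant `C` in the conclusion depends only on the constants `α`, `β` implied in
`k (n - k) = Θ(n²)` and `c` implied in the lower bound on `μ`. -/
theorem theorem5p1 (α β c : ℝ) (hα : 0 < α) (hβ : 0 < β) (hc : 0 < c) :
    ∃ C : ℝ, 0 < C ∧
      ∀ (q : ℝ), 1 ≤ q →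
      ∀ (I : ℕ → Finset ℕ),
        (∀ n, I n ⊆ Finset.Icc 0 n) →
        (∀ n, (I n : Set ℕ).OrdConnected) →
        Filter.Tendsto (fun n => (I n).card) Filter.atTop Filter.atTop →
        (∀ᶠ n : ℕ in Filter.atTop, ∀ k ∈ I n,
          α * (n : ℝ) ^ 2 ≤ (k : ℝ) * ((n : ℝ) - k) ∧
            (k : ℝ) * ((n : ℝ) - k) ≤ β * (n : ℝ) ^ 2) →
      ∀ (μ : (n : ℕ) → PMF (BoolInput n)),
        (∀ᶠ n : ℕ in Filter.atTop, ∀ X : BoolInput n, X.weight ∈ I n →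
          c * ((I n).card : ℝ)⁻¹ * (1 / (n.choose X.weight : ℝ)) ≤ (μ n X).toReal) →
      ∀ (ε : ℕ → ℝ),
        (∀ n, 0 < ε n) →
        ε =o[Filter.atTop] (fun n : ℕ => ((I n).card : ℝ) / n) →
        ∀ᶠ n : ℕ in Filter.atTop, ∀ A : MeanQueryAlgorithm n,
          A.avgExpectedError q (μ n) ≤ ε n →
            C * min (ε n)⁻¹ (n : ℝ) ≤ (A.queries : ℝ) := by
  refine ⟨α / 32 * min (c / 24) 1, by positivity, ?_⟩
  intro q hq I hIn hI hIcard hk μ hμ ε hε hεo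
  -- With `96 = 4 · 24` the unrounded shift `x` is at most `|I| / 4`; since `|I| ≥ 4`, rounding up
  -- keeps `d ≤ |I| / 2`.
  have hsmall := hεo.def (c := c / 96) (by positivity)
  filter_upwards [hk, hμ, hsmall, hIcard.eventually_ge_atTop 4, Filter.eventually_gt_atTop 0]
    with n hk hμ hsmall hcard hn A hA
  have hn' : (0 : ℝ) < n := by exact_mod_cast hn
  have he := hε n
  have hcard4 : (4 : ℝ) ≤ (I n).card := by exact_mod_cast hcard
  have hsmall' : ε n * n ≤ c / 96 * (I n).card := by
    rw [Real.norm_of_nonneg he.le, Real.norm_of_nonneg (by positivity), ← mul_div_assoc,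
      le_div_iff₀ hn'] at hsmall
    exact hsmall
  -- The factor `24` makes the error term `12 n (ε / c)` equal to `x / 2`, so it absorbs at most
  -- half of `d`.
  set x : ℝ := 24 / c * (ε n * n) with hx
  have hx0 : 0 < x := by positivity
  have hxI : x ≤ (I n).card / 4 := by
    calc x ≤ 24 / c * (c / 96 * (I n).card) := by rw [hx]; gcongr
      _ = (I n).card / 4 := by field_simp; norm_num
  have hd : 0 < ⌈x⌉₊ := Nat.ceil_pos.2 hx0
  have hxd : x ≤ ⌈x⌉₊ := Nat.le_ceil x
  have hdx : (⌈x⌉₊ : ℝ) < x + 1 := Nat.ceil_lt_add_one hx0.le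
  set d := ⌈x⌉₊
  have hdI : 2 * d ≤ (I n).card := by
    have : (2 : ℝ) * d ≤ (I n).card := by linarith
    exact_mod_cast this
  have hδ : ∑ k ∈ I n, A.layerError k ≤ (I n).card * (ε n / c) := by
    have h := (A.sum_layerError_le_avgExpectedError hq (μ n) (I n) hμ).trans hA
    have hI0 : (0 : ℝ) < (I n).card := by linarith
    rw [← div_eq_mul_inv, div_mul_eq_mul_div, div_le_iff₀ hI0] at h
    rw [← mul_div_assoc, le_div_iff₀ hc]
    linarith
  have hmain := A.shift_le_of_sum_layerError_le hn (hIn n) (hI n)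
    (Finset.card_pos.1 (by omega)) hα (fun k hkI => (hk k hkI).1) hd hdI hδ
  have hd' : (0 : ℝ) < d := by exact_mod_cast hd
  have hhalf : 12 * n * (ε n / c) = x / 2 := by rw [hx]; ring
  rw [hhalf] at hmain
  have hquery : α * n ≤ 16 * A.queries * d := by
    have h1 : (d : ℝ) / 2 ≤ 8 * A.queries * d ^ 2 / (α * n) := by linarith
    rw [le_div_iff₀ (by positivity)] at h1
    refine le_of_mul_le_mul_left (a := (d : ℝ)) ?_ hd'
    linarith
  set m := min (c / 24) 1
  set M := min (ε n)⁻¹ (n : ℝ)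
  have hm0 : 0 ≤ m := by positivity
  have hM0 : 0 ≤ M := by positivity
  have hmM : m * M ≤ n :=
    (mul_le_mul (min_le_right _ _) (min_le_right _ _) hM0 zero_le_one).trans_eq (one_mul _)
  have hxmM : x * (m * M) ≤ n := by
    calc x * (m * M) ≤ x * (c / 24 * (ε n)⁻¹) := by
          gcongr
          exacts [min_le_left _ _, min_le_left _ _]
      _ = n := by rw [hx]; field_simp
  -- From `d < x + 1`: the `ε⁻¹` side of the minimum handles `x`, and the `n` side handles the
  -- rounding.
  have hdmM : d * (m * M) ≤ 2 * n := by
    have := mul_le_mul_of_nonneg_right hdx.le (mul_nonneg hm0 hM0)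
    linarith
  refine le_of_mul_le_mul_left (a := (d : ℝ)) ?_ hd'
  have h := mul_le_mul_of_nonneg_left hdmM hα.le
  linarith
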